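/- **Setting.** Both objectives are minimized; $x(p),y(p)$ are the coordinates of $p\in\mathbb R^2$. For $\epsilon>0$, a point $p$ *$\epsilon$-covers* $q$ if $p\le(1+\epsilon)q$ coordinatewise. An *$\epsilon$-convex Pareto set* of $I\subseteq\mathbb R^2_{+}$ is a subset $Q\subseteq I$ such that every point of $I$ is $\epsilon$-covered by a convex combination of points of $Q$; $\mathrm{OPT}_\epsilon(I)$ is the minimum number of points in such a set. The ratio distance is $\mathcal{RD}(p,q)=\max\{x(q)/x(p)-1,\;y(q)/y(p)-1,\;0\}$, and $\mathcal{RD}(p,lr)=\inf_{q\in lr}\mathcal{RD}(p,q)$ for a segment $lr$. An exact oracle $\mathrm{Comb}$ for $I$ returns, for $\lambda\in[0,\infty)$, a point of $I$ minimizing $y+\lambda x$, and, for $\lambda=\infty$, a point of $I$ minimizing $x$ (ties are broken arbitrarily). **The Chord algorithm** computes $a=\mathrm{Comb}(\infty)$, $b=\mathrm{Comb}(0)$, $c=(x(a),y(b))$ and calls $\mathrm{Chord}(\{a,b,c\},\epsilon)$. The routine $\mathrm{Chord}(\{l,r,s\},\epsilon)$ returns if $\mathcal{RD}(s,lr)\le\epsilon$.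 Otherwise it calls $q=\mathrm{Comb}(\lambda_{lr})$, where $\lambda_{lr}$ is the absolute slope of $lr$, and returns if $\mathcal{RD}(q,lr)\le\epsilon$. Otherwise it recurses on $\{l,q,s_l\}$ and $\{q,r,s_r\}$, where $s_l,s_r$ are the intersections of the lines $ls$, $rs$ with the line through $q$ parallel to $lr$. The nodes of the *recursion tree* are the calls of the routine that call $\mathrm{Comb}$, that is, those with $\mathcal{RD}(s,lr)>\epsilon$. $\mathrm{Chord}_\epsilon(I)$ is the total number of calls to $\mathrm{Comb}$. **Random instances.** Given points $a,b$ with $x(a)<x(b)$, $y(b)<y(a)$ and an intensity $\nu>0$, let $c=(x(a),y(b))$, let $T_1=\triangle(abc)$, of area $S(T_1)$, and let $I=\{a,b\}\cup\Phi$, where $\Phi$ is a Poisson point process of intensity $\nu$ on $T_1$: a random finite subset of $T_1$ such that the number of its points in a measurable $A\subseteq T_1$ is Poisson with parameter $\nu S(A)$ and the numbers of points in disjoint measurable sets are mutually independent. **Theorem.** There are absolute constants $C,p,\epsilon_0,k_1,k_2>0$ such that for all integers $m\ge1$ and all $0<\epsilon<\epsilon_0$ there are $a,b,\nu$ as above with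 $T_1\subseteq[2^{-m},2^m]^2$ and $$(2^m/\epsilon)^{k_1}\le\nu S(T_1)\le(2^m/\epsilon)^{k_2},$$ for which, for every exact oracle $\mathrm{Comb}$: 1. $\mathrm{OPT}_\epsilon(I)\le3$ almost surely; 2. the expected performance ratio of the Chord algorithm satisfies $$\mathbb E\left[\frac{\mathrm{Chord}_\epsilon(I)}{\mathrm{OPT}_\epsilon(I)}\right]\ge C\log\log(\nu S(T_1))\quad\text{and}\quad \mathbb E\left[\frac{\mathrm{Chord}_\epsilon(I)}{\mathrm{OPT}_\epsilon(I)}\right]\ge C\left(\log m+\log\log\frac1\epsilon\right);$$ 3. with probability at least $p$, the recursion tree has a path starting at the root of length at least $C\log\log(\nu S(T_1))$ and at least $C\log\log(1/\epsilon)$. -/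

import Mathlib

open Set MeasureTheory ProbabilityTheory
open scoped ENNReal NNReal

universe u

namespace ChordPPP

/-- The objective plane; `p.1` is the `x`-objective, `p.2` the `y`-objective, and `p ≤ q` is the
coordinatewise order. Both objectives are minimized. -/
abbrev Point : Type := ℝ × ℝ

/-! ### Convex Pareto sets and the ratio distance -/

/-- `p` `ε`-covers `q`. -/
def Covers (ε : ℝ) (p q : Point) : Prop := p ≤ (1 + ε) • q

/-- `S` is an `ε`-convex Pareto set of `A`: a subset of `A` whose convex combinations `ε`-cover
every point of `A`. -/
def IsEpsCP (ε : ℝ) (A S : Set Point) : Prop :=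
  S ⊆ A ∧ ∀ p ∈ A, ∃ q ∈ convexHull ℝ S, Covers ε q p

/-- The minimum number of points of an `ε`-convex Pareto set of `A`. -/
noncomputable def opt (ε : ℝ) (A : Set Point) : ℕ∞ :=
  ⨅ (S : Set Point) (_ : IsEpsCP ε A S), S.encard

/-- The ratio distance from the point `p` to the point `q`. -/
noncomputable def ratioDist (p q : Point) : ℝ :=
  max (max (q.1 / p.1 - 1) (q.2 / p.2 - 1)) 0

/-- The ratio distance from the point `p` to the segment `lr`. -/
noncomputable def ratioDistSeg (p l r : Point) : ℝ :=
  sInf (ratioDist p '' segment ℝ l r)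

/-! ### The oracle -/

/-- `comb` is an exact `Comb` routine for the objective space `A`: for `lam < ∞` the point
`comb lam` minimizes `y + lam * x` over `A`, and `comb ∞` minimizes `x`. Ties are broken in an
arbitrary way. -/
def IsExactComb (A : Set Point) (comb : ℝ≥0∞ → Point) : Prop :=
  (∀ lam, comb lam ∈ A) ∧
  (∀ lam, lam ≠ ∞ → ∀ p ∈ A,
    (comb lam).2 + lam.toReal * (comb lam).1 ≤ p.2 + lam.toReal * p.1) ∧
  ∀ p ∈ A, (comb ∞).1 ≤ p.1

/-- The absolute slope of `lr` (which is `∞` for a vertical segment). -/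
noncomputable def absSlope (l r : Point) : ℝ≥0∞ :=
  ENNReal.ofReal |l.2 - r.2| / ENNReal.ofReal |l.1 - r.1|

/-! ### The Chord algorithm -/

/-- The cross product of two plane vectors. -/
def cross (u v : Point) : ℝ := u.1 * v.2 - u.2 * v.1

/-- For `e` one of `l`, `r`: the point in which the line through `q` parallel to `lr` meets the
line `es`, written as `e + t (s - e)`. -/
noncomputable def cut (l r s q e : Point) : Point :=
  AffineMap.lineMap e s (cross (q - e) (r - l) / cross (s - e) (r - l))

/-- The recursion tree of the routine `Chord ({l, r, s}, ε)`. A node is addressed by the list of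
turns that lead to it (`false`: the call on `{l, q, s_l}`, `true`: the call on `{q, r, s_r}`). A
call is a node iff it does not return before it calls `comb`, that is iff `RD(s, lr) > ε`; then it
calls `comb` once, with the slope of `lr`, and it recurses iff the answer `q` has
`RD(q, lr) > ε`. -/
def IsNode (comb : ℝ≥0∞ → Point) (ε : ℝ) : List Bool → Point → Point → Point → Prop
  | [], l, r, s => ε < ratioDistSeg s l r
  | false :: w, l, r, s =>
      ε < ratioDistSeg s l r ∧ ε < ratioDistSeg (comb (absSlope l r)) l r ∧
        IsNode comb ε w l (comb (absSlope l r)) (cut l r s (comb (absSlope l r)) l)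
  | true :: w, l, r, s =>
      ε < ratioDistSeg s l r ∧ ε < ratioDistSeg (comb (absSlope l r)) l r ∧
        IsNode comb ε w (comb (absSlope l r)) r (cut l r s (comb (absSlope l r)) r)

/-- The recursion tree of the Chord algorithm, as the set of addresses of its nodes. It starts from
`a = Comb(∞)`, `b = Comb(0)` and `c = (x(a), y(b))`. -/
def recursionTree (comb : ℝ≥0∞ → Point) (ε : ℝ) : Set (List Bool) :=
  {w | IsNode comb ε w (comb ∞) (comb 0) ((comb ∞).1, (comb 0).2)}

/-- The number of `Comb` calls of the Chord algorithm: the two initial ones and one for every node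
of the recursion tree. -/
noncomputable def chordCalls (comb : ℝ≥0∞ → Point) (ε : ℝ) : ℕ∞ :=
  2 + (recursionTree comb ε).encard

/-! ### Poisson point processes -/

/-- The number of points of the configuration `F` in `A`. -/
noncomputable def count (F : Finset Point) (A : Set Point) : ℕ := ((F : Set Point) ∩ A).ncard

/-- `Φ` is a (homogeneous) Poisson point process of intensity `ν` on the bounded set `S`: a random
finite set of points of `S` such that the number of points in a measurable `A ⊆ S` is a Poisson
random variable of parameter `ν * area A`, and the numbers of points in disjoint sets are mutually
independent. -/
structure IsPPP {Ω : Type u} [MeasurableSpace Ω] (μ : Measure Ω) (ν : ℝ≥0) (S : Set Point)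
    (Φ : Ω → Finset Point) : Prop where
  subset : ∀ ω, (Φ ω : Set Point) ⊆ S
  measurable : ∀ A ⊆ S, MeasurableSet A → Measurable fun ω => count (Φ ω) A
  poisson : ∀ A ⊆ S, MeasurableSet A →
    μ.map (fun ω => count (Φ ω) A) = poissonMeasure (ν * (volume A).toNNReal)
  indep : ∀ (k : ℕ) (A : Fin k → Set Point), (∀ i, A i ⊆ S) → (∀ i, MeasurableSet (A i)) →
    Pairwise (fun i j => Disjoint (A i) (A j)) →
    iIndepFun (fun i ω => count (Φ ω) (A i)) μ

/-! ### The random instances -/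

/-- The root triangle `abc` for given endpoints `a`, `b`, where `c = (x(a), y(b))`. -/
def rootTriangle (a b : Point) : Set Point := convexHull ℝ {a, b, (a.1, b.2)}

/-- The instance with endpoints `a`, `b` and the points of the configuration `F`. -/
def objectiveSpace (a b : Point) (F : Finset Point) : Set Point := {a, b} ∪ (F : Set Point)

end ChordPPP

/-!
Lower bound for the Chord algorithm on Poisson instances.

The instance has `a = (1, 2 ^ m)` and `b = (1 + 2 ε, 2 ^ (-m))`. The `x`-coordinates vary by a factor
of at most `(1 + ε) ^ 2`, so two points always form an `ε`-convex Pareto set (`opt_le_two`).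

The lower bound follows only the right children, the calls on triangles `(q i, b, s i)` with
`q 0 = a` and `q (i + 1) = Comb` of the slope of `q i b`. In the affine coordinates
`u = (x - 1) / (2 ε)`, `v = (y - y(b)) / H`, `H = y(a) - y(b)`, the root triangle is the standard
triangle. If `q i` has height `v` and the process has intensity `M` in these coordinates, a line
parallel to `q i b` that sweeps up from the apex meets its first point at height about
`sqrt (v / M)`. Up to a constant, `M v` is therefore replaced by its square root in each step, and
it takes about `log log M` steps until `v` is of the order `1 / M`. As long as `v` is larger than a
multiple of `ε y(b) / H`, and the points `q i` stay near the left edge, no call returns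
(`lt_ratioDistSeg_of_low`). Hence `M` may be polynomial in `G = 2 ^ m / ε`.

The triangles are random, but no conditioning is needed. The path has `K ≈ (log log G) / 2` steps, so
at its end `M v` is still as large as `exp (exp K)`; this leaves room for brackets
`lower i ≤ v ≤ upper i` whose ratio grows by a factor `96 K ^ 2` in each step
(`eventually_exists_depth`). With such brackets each step is forced, whatever the position of `q i`
within them, by two deterministic rectangles, one that contains a point of the process and one that
contains none (`step_bounds`, `isNode_replicate`). Each of these `2 K` conditions fails with
probability at most `1 / (4 K)`, and a union bound shows that all of them hold with probability at
least `1 / 2` (`IsPPP.half_le_measureReal`). The event is described by counts alone, so it is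
measurable and does not depend on how the oracle breaks ties.
-/

namespace ChordPPP

/-! ### The ratio distance to a segment -/

/-- The infimum defining `ratioDistSeg` is attained, so a strict pointwise bound passes to it. -/
theorem lt_ratioDistSeg {ε : ℝ} {p l r : Point} (h : ∀ z ∈ segment ℝ l r, ε < ratioDist p z) :
    ε < ratioDistSeg p l r := by
  have hc : IsCompact (ratioDist p '' segment ℝ l r) := by
    rw [segment_eq_image_lineMap]
    refine (isCompact_Icc.image AffineMap.lineMap_continuous).image ?_
    unfold ratioDist
    fun_prop
  have hne : (ratioDist p '' segment ℝ l r).Nonempty := ⟨_, l, left_mem_segment ℝ l r, rfl⟩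
  obtain ⟨z, hz, hzE⟩ := hc.sInf_mem hne
  rw [ratioDistSeg, ← hzE]
  exact h z hz

/-- A point whose `x`-coordinate is close to that of `l`, and which lies much lower than `l`, is
far from the segment `lb` in ratio distance: a point of the segment that is within a factor `1 + ε`
of it in the first coordinate still has a third of the height of `l`. -/
theorem lt_ratioDistSeg_of_low {ε yb : ℝ} {p l : Point} (hε : 0 < ε) (hε' : ε ≤ 1 / 10)
    (hyb : 0 < yb) (hp : 1 ≤ p.1) (hp' : p.1 ≤ 1 + ε / 4) (hpy : yb ≤ p.2)
    (hpl : 10 * (p.2 - yb) ≤ l.2 - yb) (hl : 1 ≤ l.1) (hly : 20 * ε * yb ≤ l.2 - yb) :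
    ε < ratioDistSeg p l (1 + 2 * ε, yb) := by
  refine lt_ratioDistSeg fun z hz => ?_
  by_contra! hcon
  rw [segment_eq_image_lineMap] at hz
  obtain ⟨t, ⟨ht0, ht1⟩, rfl⟩ := hz
  simp only [ratioDist, AffineMap.lineMap_apply, vsub_eq_sub, vadd_eq_add, Prod.fst_add,
    Prod.snd_add, Prod.smul_fst, Prod.smul_snd, Prod.fst_sub, Prod.snd_sub, smul_eq_mul,
    max_le_iff, tsub_le_iff_right] at hcon
  obtain ⟨⟨h1, h2⟩, -⟩ := hcon
  rw [div_le_iff₀ (by linarith)] at h1 h2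
  have ht : t ≤ 0.65 := by
    have h3 : (ε + 1) * p.1 ≤ (ε + 1) * (1 + ε / 4) := by gcongr
    have h4 : (1 - t) * 1 ≤ (1 - t) * l.1 := by gcongr
    have h5 : ε * ε ≤ ε * (1 / 10) := by gcongr
    have h6 : ε * (2 * t) ≤ ε * 1.3 := by nlinarith
    have := le_of_mul_le_mul_left h6 hε
    linarith
  have hY : 0 < l.2 - yb := lt_of_lt_of_le (by positivity) hly
  have h3 : 0.35 * (l.2 - yb) ≤ (1 - t) * (l.2 - yb) := by gcongr; linarith
  have h4 : (ε + 1) * (p.2 - yb) ≤ 1.1 * (p.2 - yb) := by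
    gcongr
    linarith
  nlinarith

/-! ### The right child of a call -/

/-- The apex of the right child lies on the horizontal line through `b`. Its position does not
depend on the apex of the parent. -/
theorem cut_right {l s q b : Point} (hs : s.2 = b.2) (hsb : s.1 ≠ b.1) (hl : l.2 ≠ b.2) :
    cut l b s q b = (q.1 + (b.1 - l.1) * ((q.2 - b.2) / (l.2 - b.2)), b.2) := by
  have h1 : s.1 - b.1 ≠ 0 := sub_ne_zero.2 hsb
  have h2 : l.2 - b.2 ≠ 0 := sub_ne_zero.2 hl
  have h3 : b.2 - l.2 ≠ 0 := sub_ne_zero.2 hl.symm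
  refine Prod.ext ?_ ?_
  · simp only [cut, cross, AffineMap.lineMap_apply, vsub_eq_sub, vadd_eq_add, Prod.fst_add,
      Prod.smul_fst, Prod.fst_sub, Prod.snd_sub, smul_eq_mul, hs]
    field_simp
    ring
  · simp [cut, AffineMap.lineMap_apply, hs]

theorem absSlope_toReal {l r : Point} : (absSlope l r).toReal = |l.2 - r.2| / |l.1 - r.1| := by
  simp [absSlope, ENNReal.toReal_div]

theorem absSlope_ne_top {l r : Point} (h : l.1 ≠ r.1) : absSlope l r ≠ ∞ := by
  have : 0 < |l.1 - r.1| := abs_pos.2 (sub_ne_zero.2 h)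
  exact ENNReal.div_ne_top ENNReal.ofReal_ne_top (by simpa using this)

/-! ### Rectangles at the corner of the root triangle -/

/-- The rectangle `[0, γ] × [0, δ]` in the affine coordinates `u = (x - 1) / (2 ε)`,
`v = (y - yb) / H`, in which the root triangle with endpoints `(1, yb + H)` and `(1 + 2 ε, yb)` is
the standard triangle `u, v ≥ 0`, `u + v ≤ 1`. -/
def cornerRect (ε yb H γ δ : ℝ) : Set Point :=
  Icc (1, yb) (1 + 2 * ε * γ, yb + H * δ)

theorem mem_cornerRect {ε yb H γ δ : ℝ} {p : Point} :
    p ∈ cornerRect ε yb H γ δ ↔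
      (1 ≤ p.1 ∧ yb ≤ p.2) ∧ p.1 ≤ 1 + 2 * ε * γ ∧ p.2 ≤ yb + H * δ := by
  simp [cornerRect, Prod.le_def]

theorem measurableSet_cornerRect {ε yb H γ δ : ℝ} : MeasurableSet (cornerRect ε yb H γ δ) :=
  measurableSet_Icc

theorem volume_cornerRect {ε yb H γ δ : ℝ} (hε : 0 < ε) (hγ : 0 ≤ γ) :
    volume (cornerRect ε yb H γ δ) = ENNReal.ofReal (2 * ε * H * (γ * δ)) := by
  rw [cornerRect, ← Icc_prod_Icc, Measure.volume_eq_prod, Measure.prod_prod,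
    Real.volume_Icc, Real.volume_Icc, ← ENNReal.ofReal_mul (by simp; positivity)]
  congr 1
  ring

theorem cornerRect_subset_rootTriangle {ε yb H γ δ : ℝ} (hε : 0 < ε) (hH : 0 < H)
    (h : γ + δ ≤ 1) :
    cornerRect ε yb H γ δ ⊆ rootTriangle (1, yb + H) (1 + 2 * ε, yb) := by
  intro p hp
  rw [mem_cornerRect] at hp
  obtain ⟨⟨h1, h2⟩, h3, h4⟩ := hp
  have hu : (p.1 - 1) / (2 * ε) ≤ γ := by rw [div_le_iff₀ (by positivity)]; linarith
  have hv : (p.2 - yb) / H ≤ δ := by rw [div_le_iff₀ hH]; linarith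
  set u := (p.1 - 1) / (2 * ε) with hu'
  set v := (p.2 - yb) / H with hv'
  have hu0 : 0 ≤ u := div_nonneg (by linarith) (by positivity)
  have hv0 : 0 ≤ v := div_nonneg (by linarith) hH.le
  have key := (convex_convexHull ℝ ({(1, yb + H), (1 + 2 * ε, yb), (1, yb)} : Set Point)).sum_mem
    (t := Finset.univ) (w := ![v, u, 1 - u - v])
    (z := ![((1, yb + H) : Point), (1 + 2 * ε, yb), (1, yb)])
    (by simp [Fin.forall_fin_succ, hu0, hv0]; linarith) (by simp [Fin.sum_univ_three]; ring)
    (by intro i _; apply subset_convexHull; fin_cases i <;> simp)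
  have hpu : p.1 = 1 + 2 * ε * u := by rw [hu']; field_simp; ring
  have hpv : p.2 = yb + H * v := by rw [hv']; field_simp; ring
  refine (Prod.ext ?_ ?_ : _ = p) ▸ key
  · simp [Fin.sum_univ_three, hpu]
    ring
  · simp [Fin.sum_univ_three, hpv]
    ring

theorem rootTriangle_subset_Icc {ε yb H : ℝ} (hε : 0 < ε) (hH : 0 < H) :
    rootTriangle (1, yb + H) (1 + 2 * ε, yb) ⊆ Icc (1, yb) (1 + 2 * ε, yb + H) := by
  refine convexHull_min ?_ (convex_Icc _ _)
  rintro p (rfl | rfl | rfl) <;> simp [Prod.le_def, hε.le, hH.le]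

/-- One step of the algorithm. If `l` has normalized height in `[α, β]` and the instance has a
point in the corner rectangle `[0, β' / (3 β)] × [0, β' / 3]`, then the point `q` that `Comb`
returns for the slope of `lb` has normalized height at most `β'` and lies near the left edge. -/
theorem step_bounds {ε yb H α β β' : ℝ} {l p q : Point} (hε : 0 < ε) (hH : 0 < H)
    (hα : 0 < α) (hαβ : α ≤ β) (hβ' : 0 < β')
    (hl1 : 1 ≤ l.1) (hl1' : l.1 ≤ 1 + ε / 8)
    (hl2 : H * α ≤ l.2 - yb) (hl2' : l.2 - yb ≤ H * β)
    (hp : p ∈ cornerRect ε yb H (β' / (3 * β)) (β' / 3))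
    (hq1 : 1 ≤ q.1) (hq2 : yb ≤ q.2)
    (hmin : q.2 + (l.2 - yb) / (1 + 2 * ε - l.1) * q.1 ≤
      p.2 + (l.2 - yb) / (1 + 2 * ε - l.1) * p.1) :
    q.2 ≤ yb + H * β' ∧ q.1 ≤ 1 + 2 * ε * (2 * β' / (3 * α)) := by
  rw [mem_cornerRect] at hp
  obtain ⟨-, hp1, hp2⟩ := hp
  have hβ : 0 < β := hα.trans_le hαβ
  set D := 1 + 2 * ε - l.1 with hD
  have hD0 : 0 < D := by linarith
  set lam := (l.2 - yb) / D with hlam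
  have hlo : H * α ≤ lam * (2 * ε) := by
    rw [hlam, div_mul_eq_mul_div, le_div_iff₀ hD0]
    have : 0 ≤ H * α := by positivity
    have : D ≤ 2 * ε := by linarith
    calc H * α * D ≤ H * α * (2 * ε) := by gcongr
      _ ≤ _ := by gcongr
  have hup : lam * (2 * ε) ≤ 2 * (H * β) := by
    rw [hlam, div_mul_eq_mul_div, div_le_iff₀ hD0]
    have : ε ≤ D := by linarith
    calc (l.2 - yb) * (2 * ε) ≤ H * β * (2 * ε) := by gcongr
      _ = 2 * (H * β) * ε := by ring
      _ ≤ _ := by gcongr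
  have hlam0 : 0 < lam := by
    have : 0 < H * α := by positivity
    by_contra! hc
    nlinarith
  have key : (q.2 - yb) + lam * (q.1 - 1) ≤ H * (β' / 3) + lam * (2 * ε) * (β' / (3 * β)) := by
    have : lam * p.1 ≤ lam * (1 + 2 * ε * (β' / (3 * β))) := by gcongr
    linarith
  have h1 : lam * (2 * ε) * (β' / (3 * β)) ≤ 2 * (H * β) * (β' / (3 * β)) := by gcongr
  have h2 : 2 * (H * β) * (β' / (3 * β)) = 2 * (H * (β' / 3)) := by field_simp
  constructor
  · have : 0 ≤ lam * (q.1 - 1) := mul_nonneg hlam0.le (by linarith)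
    linarith
  · have h3 : lam * (q.1 - 1) ≤ lam * (2 * ε * (2 * β' / (3 * α))) := by
      have h4 : H * (β' / 3) = H * α * (β' / (3 * α)) := by field_simp
      have h5 : H * α * (β' / (3 * α)) ≤ lam * (2 * ε) * (β' / (3 * α)) := by gcongr
      have h6 : lam * (2 * ε) * (β' / (3 * β)) ≤ lam * (2 * ε) * (β' / (3 * α)) := by gcongr
      have h7 : lam * (2 * ε * (2 * β' / (3 * α))) = 2 * (lam * (2 * ε) * (β' / (3 * α))) := by
        ring
      linarith
    have := le_of_mul_le_mul_left h3 hlam0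
    linarith

/-! ### The path of right turns -/

/-- Suppose that the brackets `[α i, β i]` decrease quickly, that every corner rectangle
`[0, β (i + 1) / (3 β i)] × [0, β (i + 1) / 3]` contains a point of the instance, and that no
rectangle `[0, 2 β (i + 1) / (3 α i)] × [0, α (i + 1)]` does. Then a call whose upper endpoint has
its normalized height in the `i`-th bracket has a path of `n` right turns below it, for every `n`
with `i + n ≤ K`. -/
theorem isNode_replicate {A : Set Point} {comb : ℝ≥0∞ → Point} {ε yb H : ℝ} {K : ℕ} {α β : ℕ → ℝ}
    (hε : 0 < ε) (hε' : ε ≤ 1 / 10) (hyb : 0 < yb) (hH : 0 < H)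
    (hα : ∀ i ≤ K, 20 * ε * yb ≤ H * α i) (hαβ : ∀ i ≤ K, α i ≤ β i)
    (hdec : ∀ i < K, 16 * β (i + 1) ≤ α i)
    (hcomb : IsExactComb A comb) (hA : ∀ p ∈ A, 1 ≤ p.1 ∧ yb ≤ p.2)
    (hfull : ∀ i < K, ∃ p ∈ A, p ∈ cornerRect ε yb H (β (i + 1) / (3 * β i)) (β (i + 1) / 3))
    (hempty : ∀ i < K, ∀ p ∈ A,
      p ∉ cornerRect ε yb H (2 * β (i + 1) / (3 * α i)) (α (i + 1))) :
    ∀ (n i : ℕ) (l s : Point), i + n ≤ K → 1 ≤ l.1 → l.1 ≤ 1 + ε / 8 →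
      H * α i ≤ l.2 - yb → l.2 - yb ≤ H * β i → s.2 = yb → 1 ≤ s.1 → s.1 ≤ 1 + ε / 4 →
      IsNode comb ε (List.replicate n true) l (1 + 2 * ε, yb) s := by
  intro n
  induction n with
  | zero =>
    intro i l s hi hl1 hl1' hl2 hl2' hs2 hs1 hs1'
    have h20 := hα i (by omega)
    refine lt_ratioDistSeg_of_low hε hε' hyb hs1 hs1' hs2.ge ?_ hl1 (h20.trans hl2)
    have : 0 < 20 * ε * yb := by positivity
    linarith
  | succ n ih =>
    intro i l s hi hl1 hl1' hl2 hl2' hs2 hs1 hs1'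
    have hpos : 0 < 20 * ε * yb := by positivity
    have h20 := hα i (by omega)
    have h20' := hα (i + 1) (by omega)
    have hαi : 0 < α i := pos_of_mul_pos_right (hpos.trans_le h20) hH.le
    have hαi' : 0 < α (i + 1) := pos_of_mul_pos_right (hpos.trans_le h20') hH.le
    have hβi' : 0 < β (i + 1) := hαi'.trans_le (hαβ _ (by omega))
    have hl2pos : 0 < l.2 - yb := by linarith
    have hlb : l.1 < 1 + 2 * ε := by linarith
    set q := comb (absSlope l (1 + 2 * ε, yb)) with hq
    have hqA : q ∈ A := hcomb.1 _
    obtain ⟨hq1, hq2⟩ := hA q hqA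
    obtain ⟨p, hpA, hp⟩ := hfull i (by omega)
    have hmin := hcomb.2.1 (absSlope l (1 + 2 * ε, yb)) (absSlope_ne_top hlb.ne) p hpA
    rw [absSlope_toReal, ← hq] at hmin
    simp only [abs_of_pos hl2pos, abs_sub_comm l.1, abs_of_pos (sub_pos.2 hlb)] at hmin
    obtain ⟨hqβ, hqx⟩ := step_bounds hε hH hαi (hαβ i (by omega)) hβi' hl1 hl1' hl2 hl2' hp hq1
      hq2 hmin
    have hqα : H * α (i + 1) ≤ q.2 - yb := by
      by_contra! hc
      exact hempty i (by omega) q hqA (mem_cornerRect.2 ⟨⟨hq1, hq2⟩, hqx, by linarith⟩)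
    have hd := hdec i (by omega)
    have hqx' : q.1 ≤ 1 + ε / 12 := by
      have : 2 * β (i + 1) / (3 * α i) ≤ 1 / 24 := by
        rw [div_le_iff₀ (by positivity)]
        linarith
      nlinarith
    have hql : 16 * (q.2 - yb) ≤ l.2 - yb := by
      have : H * (16 * β (i + 1)) ≤ H * α i := by gcongr
      linarith
    have hs : ε < ratioDistSeg s l (1 + 2 * ε, yb) :=
      lt_ratioDistSeg_of_low hε hε' hyb hs1 hs1' hs2.ge (by linarith) hl1 (h20.trans hl2)
    have hqd : ε < ratioDistSeg q l (1 + 2 * ε, yb) :=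
      lt_ratioDistSeg_of_low hε hε' hyb hq1 (by linarith) hq2 (by linarith) hl1 (h20.trans hl2)
    rw [List.replicate_succ]
    refine ⟨hs, hqd, ?_⟩
    rw [← hq, cut_right hs2 (by simp; linarith) (by simp; linarith)]
    have hfrac : (q.2 - yb) / (l.2 - yb) ≤ 1 / 16 := by
      rw [div_le_iff₀ hl2pos]
      linarith
    have hfrac0 : 0 ≤ (q.2 - yb) / (l.2 - yb) := div_nonneg (by linarith) hl2pos.le
    have hprod : (1 + 2 * ε - l.1) * ((q.2 - yb) / (l.2 - yb)) ≤ 2 * ε * (1 / 16) := by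
      gcongr
      linarith
    have hprod0 : 0 ≤ (1 + 2 * ε - l.1) * ((q.2 - yb) / (l.2 - yb)) :=
      mul_nonneg (by linarith) hfrac0
    refine ih (i + 1) q _ (by omega) hq1 (by linarith) hqα (by linarith) rfl ?_ ?_
    · simp only; linarith
    · simp only; linarith

/-! ### The optimum -/

/-- If the `x`-coordinates of a finite set lie within a factor `(1 + ε)²` of each other, then two
points suffice: a lowest point among those with `x ≤ 1 + ε`, which `ε`-covers all of these, and
`b = (1 + 2 ε, yb)`, which `ε`-covers the others. -/
theorem opt_le_two {ε yb : ℝ} {A : Set Point} {a : Point} (hfin : A.Finite) (hε : 0 < ε)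
    (hyb : 0 < yb) (ha : a ∈ A) (ha1 : a.1 = 1) (hb : ((1 + 2 * ε, yb) : Point) ∈ A)
    (hA : ∀ p ∈ A, 1 ≤ p.1 ∧ yb ≤ p.2) : opt ε A ≤ 2 := by
  obtain ⟨q, ⟨hqA, hq1⟩, hqmin⟩ := exists_min_image {p ∈ A | p.1 ≤ 1 + ε} Prod.snd
    (hfin.subset (sep_subset _ _)) ⟨a, ha, by rw [ha1]; linarith⟩
  have hS : IsEpsCP ε A {q, (1 + 2 * ε, yb)} := by
    refine ⟨by rintro p (rfl | rfl) <;> assumption, fun p hp => ?_⟩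
    obtain ⟨hp1, hp2⟩ := hA p hp
    have hcov : ∀ z ∈ ({q, (1 + 2 * ε, yb)} : Set Point), z.1 ≤ (1 + ε) * p.1 → z.2 ≤ p.2 →
        ∃ z ∈ convexHull ℝ {q, (1 + 2 * ε, yb)}, Covers ε z p := by
      refine fun z hz h1 h2 => ⟨z, subset_convexHull ℝ _ hz, h1, ?_⟩
      have : 0 ≤ ε * p.2 := mul_nonneg hε.le (by linarith)
      simp only [Prod.smul_snd, smul_eq_mul]
      linarith
    by_cases hpx : p.1 ≤ 1 + ε
    · refine hcov q (by simp) ?_ (hqmin p ⟨hp, hpx⟩)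
      have : (1 + ε) * 1 ≤ (1 + ε) * p.1 := by gcongr
      linarith
    · refine hcov (1 + 2 * ε, yb) (by simp) ?_ hp2
      simp only
      nlinarith
  exact (iInf₂_le _ hS).trans ((encard_insert_le _ _).trans (by rw [encard_singleton]; rfl))

/-! ### Void probabilities of the Poisson process -/

theorem notMem_of_count_eq_zero {F : Finset Point} {A : Set Point} (h : count F A = 0)
    {p : Point} (hp : p ∈ F) : p ∉ A := by
  intro hpA
  rw [count, ncard_eq_zero (F.finite_toSet.inter_of_left A)] at h
  exact h.le ⟨hp, hpA⟩

theorem exists_mem_of_count_ne_zero {F : Finset Point} {A : Set Point} (h : count F A ≠ 0) :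
    ∃ p ∈ F, p ∈ A :=
  nonempty_of_ncard_ne_zero h

section

variable {Ω : Type u} [MeasurableSpace Ω] {μ : Measure Ω} {ν : ℝ≥0} {S A : Set Point}
  {Φ : Ω → Finset Point}

theorem IsPPP.measureReal_count_eq_zero (h : IsPPP μ ν S Φ) (hA : A ⊆ S)
    (hm : MeasurableSet A) :
    μ.real {ω | count (Φ ω) A = 0} = Real.exp (-(ν * volume.real A)) := by
  have h1 : μ.real {ω | count (Φ ω) A = 0} =
      (μ.map fun ω => count (Φ ω) A).real {0} := by
    rw [map_measureReal_apply (h.measurable A hA hm) (measurableSet_singleton 0)]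
    rfl
  rw [h1, h.poisson A hA hm, poissonMeasure_real_singleton]
  simp [measureReal_def, ENNReal.coe_toNNReal_eq_toReal]

theorem IsPPP.measurableSet_count_eq_zero (h : IsPPP μ ν S Φ) (hA : A ⊆ S)
    (hm : MeasurableSet A) : MeasurableSet {ω | count (Φ ω) A = 0} :=
  h.measurable A hA hm (measurableSet_singleton 0)

/-- A union bound: with probability at least `1 / 2`, the process meets each of the `K` sets `B i`
of mean count at least `4 K` and misses the set `Z` of mean count at most `1 / 4`. -/
theorem IsPPP.half_le_measureReal [IsProbabilityMeasure μ] (h : IsPPP μ ν S Φ) {K : ℕ}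
    (hK : 1 ≤ K) {B : ℕ → Set Point} {Z : Set Point} (hB : ∀ i < K, B i ⊆ S)
    (hBm : ∀ i < K, MeasurableSet (B i)) (hZ : Z ⊆ S) (hZm : MeasurableSet Z)
    (hBv : ∀ i < K, 4 * (K : ℝ) ≤ ν * volume.real (B i)) (hZv : ν * volume.real Z ≤ 1 / 4) :
    MeasurableSet {ω | (∀ i < K, count (Φ ω) (B i) ≠ 0) ∧ count (Φ ω) Z = 0} ∧
    1 / 2 ≤ μ.real {ω | (∀ i < K, count (Φ ω) (B i) ≠ 0) ∧ count (Φ ω) Z = 0} := by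
  have hK0 : (0 : ℝ) < K := by exact_mod_cast hK
  set E := {ω | (∀ i < K, count (Φ ω) (B i) ≠ 0) ∧ count (Φ ω) Z = 0}
  set bad := (⋃ i ∈ Finset.range K, {ω | count (Φ ω) (B i) = 0}) ∪ {ω | count (Φ ω) Z = 0}ᶜ
  have hbadm : MeasurableSet bad :=
    (Finset.measurableSet_biUnion _ fun i hi =>
      h.measurableSet_count_eq_zero (hB i (Finset.mem_range.1 hi))
        (hBm i (Finset.mem_range.1 hi))).union (h.measurableSet_count_eq_zero hZ hZm).compl
  have hE : E = badᶜ := by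
    ext ω
    simp [E, bad]
  refine ⟨hE ▸ hbadm.compl, ?_⟩
  have h1 : ∀ i ∈ Finset.range K, μ.real {ω | count (Φ ω) (B i) = 0} ≤ 1 / (4 * K) := by
    intro i hi
    have hi := Finset.mem_range.1 hi
    rw [h.measureReal_count_eq_zero (hB i hi) (hBm i hi), Real.exp_neg, one_div]
    have := Real.add_one_le_exp (ν * volume.real (B i))
    have := hBv i hi
    gcongr
    linarith
  have h2 : μ.real {ω | count (Φ ω) Z = 0}ᶜ ≤ 1 / 4 := by
    rw [probReal_compl_eq_one_sub (h.measurableSet_count_eq_zero hZ hZm),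
      h.measureReal_count_eq_zero hZ hZm]
    have := Real.one_sub_le_exp_neg (ν * volume.real Z)
    linarith
  have h3 : μ.real bad ≤ 1 / 2 := by
    calc μ.real bad ≤ ∑ i ∈ Finset.range K, μ.real {ω | count (Φ ω) (B i) = 0} +
          μ.real {ω | count (Φ ω) Z = 0}ᶜ :=
          (measureReal_union_le _ _).trans (by gcongr; exact measureReal_biUnion_finset_le _ _)
      _ ≤ ∑ i ∈ Finset.range K, 1 / (4 * (K : ℝ)) + 1 / 4 := by gcongr with i hi; exact h1 i hi
      _ = 1 / 2 := by
        rw [Finset.sum_const, Finset.card_range, nsmul_eq_mul]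
        field_simp
        norm_num
  rw [hE, probReal_compl_eq_one_sub hbadm]
  linarith

end

/-! ### The path in a good configuration -/

/-- A configuration that meets the prescribed corner rectangles and misses the others, and that
has no point on the two legs of the root triangle, forces a path of `K` right turns. -/
theorem replicate_mem_recursionTree {F : Finset Point} {comb : ℝ≥0∞ → Point} {ε yb H : ℝ} {K : ℕ}
    {α β : ℕ → ℝ} (hε : 0 < ε) (hε' : ε ≤ 1 / 10) (hyb : 0 < yb) (hH : 0 < H)
    (hF : (F : Set Point) ⊆ rootTriangle (1, yb + H) (1 + 2 * ε, yb))
    (hα : ∀ i ≤ K, 20 * ε * yb ≤ H * α i) (hαβ : ∀ i ≤ K, α i ≤ β i)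
    (hα0 : α 0 = 1) (hβ0 : β 0 = 1) (hβ : ∀ i < K, β (i + 1) < 1)
    (hdec : ∀ i < K, 16 * β (i + 1) ≤ α i)
    (hcomb : IsExactComb (objectiveSpace (1, yb + H) (1 + 2 * ε, yb) F) comb)
    (hfull : ∀ i < K, ∃ p ∈ F, p ∈ cornerRect ε yb H (β (i + 1) / (3 * β i)) (β (i + 1) / 3))
    (hempty : ∀ i < K, ∀ p ∈ F,
      p ∉ cornerRect ε yb H (2 * β (i + 1) / (3 * α i)) (α (i + 1)))
    (hleft : ∀ p ∈ F, p ∉ cornerRect ε yb H 0 1) (hbot : ∀ p ∈ F, p ∉ cornerRect ε yb H 1 0)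
    {n : ℕ} (hn : n ≤ K) :
    List.replicate n true ∈ recursionTree comb ε := by
  set A := objectiveSpace (1, yb + H) (1 + 2 * ε, yb) F with hAdef
  have hbox : ∀ p ∈ F, (1 ≤ p.1 ∧ yb ≤ p.2) ∧ p.1 ≤ 1 + 2 * ε ∧ p.2 ≤ yb + H := by
    intro p hp
    simpa [Prod.le_def] using rootTriangle_subset_Icc hε hH (hF hp)
  have hA : ∀ p ∈ A, 1 ≤ p.1 ∧ yb ≤ p.2 := by
    rintro p ((rfl | rfl) | hp)
    · simp [hH.le]
    · simp [hε.le]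
    · exact (hbox p hp).1
  have ha : comb ∞ = (1, yb + H) := by
    have h1 : (comb ∞).1 ≤ 1 := hcomb.2.2 (1, yb + H) (by simp [hAdef, objectiveSpace])
    rcases hcomb.1 ∞ with (h | h) | h
    · exact h
    · rw [h] at h1
      simp only at h1
      linarith
    · refine absurd (mem_cornerRect.2 ⟨(hbox _ h).1, ?_, ?_⟩) (hleft _ h)
      · simpa using h1
      · simpa using (hbox _ h).2.2
  have hb : comb 0 = (1 + 2 * ε, yb) := by
    have h1 := hcomb.2.1 0 ENNReal.zero_ne_top (1 + 2 * ε, yb) (by simp [hAdef, objectiveSpace])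
    simp only [ENNReal.toReal_zero, zero_mul, add_zero] at h1
    rcases hcomb.1 0 with (h | h) | h
    · rw [h] at h1
      simp only at h1
      linarith
    · exact h
    · refine absurd (mem_cornerRect.2 ⟨(hbox _ h).1, ?_, ?_⟩) (hbot _ h)
      · simpa using (hbox _ h).2.1
      · simpa using h1
  rw [recursionTree, mem_ofPred_eq, ha, hb]
  refine isNode_replicate hε hε' hyb hH hα hαβ hdec hcomb hA ?_ ?_ n 0 _ _ (by omega)
    (by simp) (by simp only; linarith) (by simp [hα0]) (by simp [hβ0]) rfl (by simp)
    (by simp only; linarith)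
  · intro i hi
    obtain ⟨p, hp, hp'⟩ := hfull i hi
    exact ⟨p, Or.inr hp, hp'⟩
  · have hpos : 0 < 20 * ε * yb := by positivity
    rintro i hi p ((rfl | rfl) | hp)
    · rw [mem_cornerRect]
      rintro ⟨-, -, h⟩
      have : H * α (i + 1) < H * 1 :=
        mul_lt_mul_of_pos_left ((hαβ (i + 1) hi).trans_lt (hβ i hi)) hH
      simp only at h
      linarith
    · rw [mem_cornerRect]
      rintro ⟨-, h, -⟩
      have hαi : 0 < α i := pos_of_mul_pos_right (hpos.trans_le (hα i hi.le)) hH.le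
      have : 2 * β (i + 1) / (3 * α i) ≤ 1 / 24 := by
        rw [div_le_iff₀ (by positivity)]
        linarith [hdec i hi]
      simp only at h
      nlinarith
    · exact hempty i hi p hp

/-- A tree that contains the `K + 1` paths of `n ≤ K` right turns costs at least `K` calls. -/
theorem le_chordCalls {comb : ℝ≥0∞ → Point} {ε : ℝ} {K : ℕ}
    (h : ∀ n ≤ K, List.replicate n true ∈ recursionTree comb ε) : (K : ℕ∞) ≤ chordCalls comb ε := by
  have h1 : (fun n => List.replicate n true) '' (Finset.range K : Set ℕ) ⊆
      recursionTree comb ε := by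
    rintro _ ⟨n, hn, rfl⟩
    exact h n (Finset.mem_range.1 hn).le
  have h2 := encard_le_encard h1
  rw [(List.replicate_left_injective true).encard_image, encard_coe_eq_coe_finsetCard,
    Finset.card_range] at h2
  exact h2.trans le_add_self

/-! ### Choice of the depth and of the brackets -/

/-- The depth `K` is about half of `log log G`. Then the `2 ^ K`-th root `R` of `G` is at least
`exp (exp K)`, which dominates the factor `(96 K²) ^ K` that the brackets lose in `K` steps. -/
theorem eventually_exists_depth : ∀ᶠ G : ℝ in Filter.atTop, ∃ (K : ℕ) (R : ℝ), 1 ≤ K ∧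
    R ^ 2 ^ K = G ∧ 16 * (96 * (K : ℝ) ^ 2) ^ K ≤ R ∧ 36 * (K : ℝ) ≤ G ∧
    1 ≤ Real.log G ∧ Real.log (Real.log G) ≤ 4 * K := by
  have hpoly : ∀ᶠ K : ℕ in Filter.atTop, 3 + 96 * (K : ℝ) ^ 3 ≤ Real.exp K := by
    have h1 := (Real.isLittleO_pow_exp_atTop (n := 3)).bound (c := 1 / 192) (by norm_num)
    have h2 := h1.and (Real.tendsto_exp_atTop.eventually_ge_atTop 6)
    filter_upwards [tendsto_natCast_atTop_atTop.eventually h2] with K hK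
    obtain ⟨h3, h4⟩ := hK
    rw [Real.norm_of_nonneg (by positivity), Real.norm_of_nonneg (by positivity)] at h3
    linarith
  have hlin : ∀ᶠ K : ℕ in Filter.atTop, 36 * (K : ℝ) ≤ Real.exp K := by
    have h1 := (Real.isLittleO_pow_exp_atTop (n := 1)).bound (c := 1 / 36) (by norm_num)
    filter_upwards [tendsto_natCast_atTop_atTop.eventually h1] with K h3
    rw [Real.norm_of_nonneg (by positivity), Real.norm_of_nonneg (by positivity)] at h3
    linarith
  have hL : Filter.Tendsto (fun G => Real.log (Real.log G)) Filter.atTop Filter.atTop :=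
    Real.tendsto_log_atTop.comp Real.tendsto_log_atTop
  have hK : Filter.Tendsto (fun G => ⌊Real.log (Real.log G) / 2⌋₊) Filter.atTop Filter.atTop :=
    tendsto_nat_floor_atTop.comp (hL.atTop_div_const (by norm_num))
  filter_upwards [hK.eventually hpoly, hK.eventually hlin, hK.eventually_ge_atTop 1,
    hL.eventually_ge_atTop 0, Real.tendsto_log_atTop.eventually_ge_atTop 1,
    Filter.eventually_gt_atTop 0] with G h1 h2 h3 h4 h5 h6
  set K := ⌊Real.log (Real.log G) / 2⌋₊ with hKdef
  have hK1 : (1 : ℝ) ≤ K := by exact_mod_cast h3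
  have hKL : (K : ℝ) ≤ Real.log (Real.log G) / 2 := Nat.floor_le (by linarith)
  have hLK : Real.log (Real.log G) / 2 < K + 1 := Nat.lt_floor_add_one _
  have hlogG : Real.exp (2 * K) ≤ Real.log G := by
    rw [← Real.le_log_iff_exp_le (by linarith)]
    linarith
  have hroot : Real.exp K ≤ Real.log G / 2 ^ K := by
    rw [le_div_iff₀ (by positivity)]
    have h7 : (2 : ℝ) ^ K ≤ Real.exp K := by
      rw [← Real.exp_one_pow]
      gcongr
      linarith [Real.add_one_le_exp 1]
    calc Real.exp K * 2 ^ K ≤ Real.exp K * Real.exp K := by gcongr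
      _ = Real.exp (2 * K) := by rw [← Real.exp_add]; ring_nf
      _ ≤ _ := hlogG
  refine ⟨K, Real.exp (Real.log G / 2 ^ K), h3, ?_, ?_, ?_, h5, by linarith⟩
  · rw [← Real.exp_nat_mul]
    push_cast
    rw [mul_div_cancel₀ _ (by positivity), Real.exp_log h6]
  · calc 16 * (96 * (K : ℝ) ^ 2) ^ K ≤ Real.exp 3 * Real.exp (96 * (K : ℝ) ^ 2) ^ K := by
          have h8 : (16 : ℝ) ≤ Real.exp 3 := by
            have : Real.exp 3 = Real.exp 1 ^ 3 := by rw [← Real.exp_nat_mul]; norm_num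
            rw [this]
            calc (16 : ℝ) ≤ 2.7 ^ 3 := by norm_num
              _ ≤ _ := by gcongr; linarith [Real.exp_one_gt_d9]
          gcongr
          linarith [Real.add_one_le_exp (96 * (K : ℝ) ^ 2)]
      _ = Real.exp (3 + 96 * (K : ℝ) ^ 3) := by
          rw [← Real.exp_nat_mul, ← Real.exp_add]
          ring_nf
      _ ≤ Real.exp (Real.log G / 2 ^ K) := by
          gcongr
          linarith
  · calc 36 * (K : ℝ) ≤ Real.exp K := h2
      _ ≤ Real.exp (2 * K) := by gcongr; linarith
      _ ≤ Real.log G := hlogG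
      _ ≤ G := Real.log_le_self h6.le

/-- The upper end of the `i`-th bracket for the normalized height. It satisfies
`β (i + 1) ^ 2 = β i / G`: the height of the next endpoint is of the order of the height of the
first point of the process that a line sweeping the current triangle meets. -/
noncomputable def upper (G R : ℝ) (K i : ℕ) : ℝ := R ^ 2 ^ (K - i) / G

/-- The lower end of the `i`-th bracket for the normalized height; each step loses a factor
`ρ`. -/
noncomputable def lower (G R ρ : ℝ) (K i : ℕ) : ℝ := upper G R K i / ρ ^ i

section

variable {G R ρ : ℝ} {K : ℕ}

theorem upper_zero (hG : 0 < G) (hR : R ^ 2 ^ K = G) : upper G R K 0 = 1 := by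
  simp [upper, hR, hG.ne']

theorem lower_zero (hG : 0 < G) (hR : R ^ 2 ^ K = G) : lower G R ρ K 0 = 1 := by
  simp [lower, upper_zero hG hR]

theorem upper_pos (hG : 0 < G) (hR : 0 < R) (i : ℕ) : 0 < upper G R K i := by
  unfold upper
  positivity

theorem lower_le_upper (hG : 0 < G) (hR : 0 < R) (hρ : 1 ≤ ρ) (i : ℕ) :
    lower G R ρ K i ≤ upper G R K i :=
  div_le_self (upper_pos hG hR i).le (one_le_pow₀ hρ)

theorem upper_succ_sq (hG : 0 < G) {i : ℕ} (hi : i < K) :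
    upper G R K (i + 1) ^ 2 = upper G R K i / G := by
  have h : K - i = (K - (i + 1)) + 1 := by omega
  rw [upper, upper, h, pow_succ 2, pow_mul]
  field_simp

theorem le_pow_two_pow (hR : 1 ≤ R) (n : ℕ) : R ≤ R ^ 2 ^ n :=
  le_self_pow₀ hR (by positivity)

theorem le_lower (hG : 0 < G) (hρ : 1 ≤ ρ) (hR : 16 * ρ ^ K ≤ R) {i : ℕ} (hi : i ≤ K) :
    16 / G ≤ lower G R ρ K i := by
  have hK : 1 ≤ ρ ^ K := one_le_pow₀ hρ
  have h1 : R ≤ R ^ 2 ^ (K - i) := le_pow_two_pow (by linarith) _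
  have h2 : ρ ^ i ≤ ρ ^ K := pow_le_pow_right₀ hρ hi
  have h3 : 0 < ρ ^ i := by positivity
  rw [lower, upper, div_div, div_le_div_iff₀ hG (by positivity)]
  calc 16 * (G * ρ ^ i) ≤ 16 * (G * ρ ^ K) := by gcongr
    _ = 16 * ρ ^ K * G := by ring
    _ ≤ R ^ 2 ^ (K - i) * G := by gcongr; linarith

theorem upper_succ_le_lower (hG : 0 < G) (hρ : 1 ≤ ρ) (hR : 16 * ρ ^ K ≤ R) {i : ℕ} (hi : i < K) :
    16 * upper G R K (i + 1) ≤ lower G R ρ K i := by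
  have hK : 1 ≤ ρ ^ K := one_le_pow₀ hρ
  have hR0 : 0 < R := by linarith
  have h1 : R ≤ R ^ 2 ^ (K - (i + 1)) := le_pow_two_pow (by linarith) _
  have h2 : ρ ^ i ≤ ρ ^ K := pow_le_pow_right₀ hρ hi.le
  have h4 : upper G R K i = upper G R K (i + 1) * R ^ 2 ^ (K - (i + 1)) := by
    have := upper_succ_sq (R := R) hG hi
    rw [eq_div_iff hG.ne', sq] at this
    rw [← this, mul_assoc]
    congr 1
    rw [upper]
    field_simp
  rw [lower, le_div_iff₀ (by positivity), h4]
  have := upper_pos (K := K) hG hR0 (i + 1)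
  calc 16 * upper G R K (i + 1) * ρ ^ i = upper G R K (i + 1) * (16 * ρ ^ i) := by ring
    _ ≤ _ := by gcongr; linarith

theorem lower_le_one (hG : 0 < G) (hρ : 1 ≤ ρ) (hR : 16 * ρ ^ K ≤ R) (hRG : R ^ 2 ^ K = G) {i : ℕ} :
    i ≤ K → lower G R ρ K i ≤ 1 := by
  have hK : 1 ≤ ρ ^ K := one_le_pow₀ hρ
  have hR0 : 0 < R := by linarith
  induction i with
  | zero => exact fun _ => (lower_zero hG hRG).le
  | succ i ih =>
    intro hi
    have h1 := upper_succ_le_lower hG hρ hR hi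
    have h2 := lower_le_upper (K := K) hG hR0 hρ (i + 1)
    have h3 := upper_pos (K := K) hG hR0 (i + 1)
    linarith [ih (by omega)]

/-- The normalized area of a rectangle that has to contain a point. -/
theorem area_full (hG : 0 < G) (hR : 0 < R) {i : ℕ} (hi : i < K) :
    upper G R K (i + 1) / (3 * upper G R K i) * (upper G R K (i + 1) / 3) = 1 / (9 * G) := by
  have h := upper_succ_sq (R := R) hG hi
  have h1 := upper_pos (K := K) hG hR i
  rw [div_mul_div_comm, ← sq, h]
  field_simp
  norm_num

/-- The normalized area of a rectangle that has to be empty. -/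
theorem area_empty (hG : 0 < G) (hR : 0 < R) (hρ : 0 < ρ) {i : ℕ} (hi : i < K) :
    2 * upper G R K (i + 1) / (3 * lower G R ρ K i) * lower G R ρ K (i + 1) =
      2 / (3 * G * ρ) := by
  have h := upper_succ_sq (R := R) hG hi
  have h1 := upper_pos (K := K) hG hR i
  rw [eq_div_iff hG.ne'] at h
  rw [lower, lower, ← h]
  have h2 := upper_pos (K := K) hG hR (i + 1)
  field_simp
  rw [pow_succ]

end

/-! ### The random instance -/

/-- For an intensity with `36 K G` points expected in the bounding box of the root triangle, the
process forces `K` right turns with probability at least `1 / 2`, whatever the oracle. -/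
theorem IsPPP.exists_event {Ω : Type u} [MeasurableSpace Ω] {μ : Measure Ω}
    [IsProbabilityMeasure μ] {Φ : Ω → Finset Point} {comb : Ω → ℝ≥0∞ → Point}
    {ε yb H G R : ℝ} {K : ℕ} {ν : ℝ≥0}
    (hε : 0 < ε) (hε' : ε ≤ 1 / 10) (hyb : 0 < yb) (hH : 0 < H) (hG : 0 < G)
    (hHG : 20 * ε * yb ≤ H * (16 / G)) (hK : 1 ≤ K) (hRG : R ^ 2 ^ K = G)
    (hR : 16 * (96 * (K : ℝ) ^ 2) ^ K ≤ R) (hν : ν * (2 * ε * H) = 36 * K * G)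
    (h : IsPPP μ ν (rootTriangle (1, yb + H) (1 + 2 * ε, yb)) Φ)
    (hcomb : ∀ ω, IsExactComb (objectiveSpace (1, yb + H) (1 + 2 * ε, yb) (Φ ω)) (comb ω)) :
    ∃ E : Set Ω, MeasurableSet E ∧ 1 / 2 ≤ μ.real E ∧
      ∀ ω ∈ E, ∀ n ≤ K, List.replicate n true ∈ recursionTree (comb ω) ε := by
  have hK1 : (1 : ℝ) ≤ K := by exact_mod_cast hK
  set ρ : ℝ := 96 * (K : ℝ) ^ 2 with hρdef
  have hρ : 1 ≤ ρ := by nlinarith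
  have hR0 : 0 < R := lt_of_lt_of_le (by positivity) hR
  set α := lower G R ρ K
  set β := upper G R K
  have hβ0 : ∀ i, 0 < β i := upper_pos hG hR0
  have hα : ∀ i ≤ K, 16 / G ≤ α i := fun i hi => le_lower hG hρ hR hi
  have hα0 : ∀ i ≤ K, 0 < α i := fun i hi => lt_of_lt_of_le (by positivity) (hα i hi)
  have hαβ : ∀ i, α i ≤ β i := lower_le_upper hG hR0 hρ
  have hdec : ∀ i < K, 16 * β (i + 1) ≤ α i := fun i hi => upper_succ_le_lower hG hρ hR hi
  have hα1 : ∀ i ≤ K, α i ≤ 1 := fun i hi => lower_le_one hG hρ hR hRG hi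
  -- the mean number of points in a corner rectangle
  have hmean : ∀ γ δ : ℝ, 0 ≤ γ → 0 ≤ δ →
      ν * volume.real (cornerRect ε yb H γ δ) = 36 * K * G * (γ * δ) := by
    intro γ δ hγ hδ
    rw [measureReal_def, volume_cornerRect hε hγ, ENNReal.toReal_ofReal (by positivity), ← mul_assoc,
      hν]
  set B : ℕ → Set Point := fun i => cornerRect ε yb H (β (i + 1) / (3 * β i)) (β (i + 1) / 3)
  set Z' : ℕ → Set Point := fun i => cornerRect ε yb H (2 * β (i + 1) / (3 * α i)) (α (i + 1))
  -- the legs of the triangle are null sets; they must be empty for `Comb` to start with `a` and `b`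
  set Z : Set Point := (⋃ i ∈ Finset.range K, Z' i) ∪ (cornerRect ε yb H 0 1 ∪
    cornerRect ε yb H 1 0)
  have hZ'sub : ∀ i < K, Z' i ⊆ rootTriangle (1, yb + H) (1 + 2 * ε, yb) := by
    intro i hi
    refine cornerRect_subset_rootTriangle hε hH ?_
    have h1 := hα0 i hi.le
    have h2 : 2 * β (i + 1) / (3 * α i) ≤ 1 / 24 := by
      rw [div_le_iff₀ (by positivity)]
      linarith [hdec i hi]
    linarith [hdec i hi, hα1 i hi.le, hαβ (i + 1)]
  have hBsub : ∀ i < K, B i ⊆ rootTriangle (1, yb + H) (1 + 2 * ε, yb) := by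
    intro i hi
    refine cornerRect_subset_rootTriangle hε hH ?_
    have h1 := hβ0 i
    have h2 : β (i + 1) / (3 * β i) ≤ 1 / 3 := by
      rw [div_le_iff₀ (by positivity)]
      linarith [hdec i hi, hαβ i, hβ0 (i + 1)]
    linarith [hdec i hi, hα1 i hi.le, hβ0 (i + 1)]
  have hZsub : Z ⊆ rootTriangle (1, yb + H) (1 + 2 * ε, yb) := by
    refine union_subset (iUnion₂_subset fun i hi => hZ'sub i (Finset.mem_range.1 hi))
      (union_subset ?_ ?_) <;>
      exact cornerRect_subset_rootTriangle hε hH (by norm_num)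
  have hZm : MeasurableSet Z :=
    (Finset.measurableSet_biUnion _ fun _ _ => measurableSet_cornerRect).union
      (measurableSet_cornerRect.union measurableSet_cornerRect)
  have hBv : ∀ i < K, 4 * (K : ℝ) ≤ ν * volume.real (B i) := by
    intro i hi
    have h1 := hβ0 i
    have h2 := hβ0 (i + 1)
    rw [hmean _ _ (by positivity) (by positivity), area_full hG hR0 hi]
    field_simp
    norm_num
  have hZv : ν * volume.real Z ≤ 1 / 4 := by
    have hle : volume.real Z ≤ ∑ i ∈ Finset.range K, volume.real (Z' i) +
        (volume.real (cornerRect ε yb H 0 1) + volume.real (cornerRect ε yb H 1 0)) :=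
      (measureReal_union_le _ _).trans
        (add_le_add (measureReal_biUnion_finset_le _ _) (measureReal_union_le _ _))
    calc ν * volume.real Z ≤ ν * (∑ i ∈ Finset.range K, volume.real (Z' i) +
          (volume.real (cornerRect ε yb H 0 1) + volume.real (cornerRect ε yb H 1 0))) := by gcongr
      _ = ∑ i ∈ Finset.range K, ν * volume.real (Z' i) := by
        rw [mul_add, mul_add, hmean 0 1 le_rfl zero_le_one, hmean 1 0 zero_le_one le_rfl,
          Finset.mul_sum]
        simp
      _ = ∑ i ∈ Finset.range K, 1 / (4 * (K : ℝ)) := by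
        refine Finset.sum_congr rfl fun i hi => ?_
        have hi := Finset.mem_range.1 hi
        have h1 := hα0 i hi.le
        have h2 := hβ0 (i + 1)
        rw [hmean _ _ (by positivity) (hα0 _ hi).le, area_empty hG hR0 (by positivity) hi, hρdef]
        field_simp
        norm_num
      _ = 1 / 4 := by
        rw [Finset.sum_const, Finset.card_range, nsmul_eq_mul]
        field_simp
  obtain ⟨hE, hEμ⟩ := h.half_le_measureReal hK (B := B) (Z := Z) hBsub
    (fun _ _ => measurableSet_cornerRect) hZsub hZm hBv hZv
  refine ⟨_, hE, hEμ, fun ω hω n hn => ?_⟩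
  obtain ⟨hfull, hZ0⟩ := hω
  have hZ0 : ∀ p ∈ Φ ω, p ∉ Z := fun p hp => notMem_of_count_eq_zero hZ0 hp
  refine replicate_mem_recursionTree hε hε' hyb hH (h.subset ω) (α := α) (β := β) (K := K) ?_
    (fun i _ => hαβ i) (lower_zero hG hRG) (upper_zero hG hRG) ?_ hdec (hcomb ω)
    (fun i hi => exists_mem_of_count_ne_zero (hfull i hi)) ?_
    (fun p hp hpZ => hZ0 p hp (Or.inr (Or.inl hpZ)))
    (fun p hp hpZ => hZ0 p hp (Or.inr (Or.inr hpZ))) hn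
  · exact fun i hi => hHG.trans (by gcongr; exact hα i hi)
  · intro i hi
    linarith [hdec i hi, hα1 i hi.le, hβ0 (i + 1)]
  · exact fun i hi p hp hpZ =>
      hZ0 p hp (Or.inl (mem_biUnion (Finset.mem_coe.2 (Finset.mem_range.2 hi)) hpZ))

/-- The area of the root triangle is at least a quarter of that of its bounding box, and at most
the whole. -/
theorem volume_rootTriangle_bounds {ε yb H : ℝ} (hε : 0 < ε) (hH : 0 < H) :
    2 * ε * H / 4 ≤ volume.real (rootTriangle (1, yb + H) (1 + 2 * ε, yb)) ∧
    volume.real (rootTriangle (1, yb + H) (1 + 2 * ε, yb)) ≤ 2 * ε * H := by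
  have hvol : ∀ γ δ : ℝ, 0 ≤ γ → 0 ≤ δ →
      volume.real (cornerRect ε yb H γ δ) = 2 * ε * H * (γ * δ) := fun γ δ hγ hδ => by
    rw [measureReal_def, volume_cornerRect hε hγ, ENNReal.toReal_ofReal (by positivity)]
  have hsub : rootTriangle (1, yb + H) (1 + 2 * ε, yb) ⊆ cornerRect ε yb H 1 1 := by
    simpa [cornerRect] using rootTriangle_subset_Icc (yb := yb) hε hH
  have hfin : volume (cornerRect ε yb H 1 1) ≠ ∞ := by
    rw [volume_cornerRect hε zero_le_one]
    exact ENNReal.ofReal_ne_top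
  constructor
  · calc 2 * ε * H / 4 = volume.real (cornerRect ε yb H (1 / 2) (1 / 2)) := by
          rw [hvol _ _ (by norm_num) (by norm_num)]
          ring
      _ ≤ _ := measureReal_mono (cornerRect_subset_rootTriangle hε hH (by norm_num))
          (measure_ne_top_of_subset hsub hfin)
  · calc _ ≤ volume.real (cornerRect ε yb H 1 1) := measureReal_mono hsub hfin
      _ = 2 * ε * H := by rw [hvol _ _ zero_le_one zero_le_one]; ring

end ChordPPP

/-! ### The lower bound -/

theorem mainTheorem10 :
    -- absolute constants
    ∃ C : ℝ, 0 < C ∧ ∃ p : ℝ, 0 < p ∧ ∃ ε₀ : ℝ, 0 < ε₀ ∧ ∃ k₁ : ℝ, 0 < k₁ ∧ ∃ k₂ : ℝ, 0 < k₂ ∧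
    -- the family of instances, given by the endpoints `a`, `b` and the intensity `ν`
    ∀ (m : ℕ) (ε : ℝ), 1 ≤ m → 0 < ε → ε < ε₀ → ∃ (a b : ChordPPP.Point) (ν : ℝ≥0),
      a.1 < b.1 ∧ b.2 < a.2 ∧
      ChordPPP.rootTriangle a b ⊆
        Set.Icc (((2 : ℝ) ^ m)⁻¹, ((2 : ℝ) ^ m)⁻¹) ((2 : ℝ) ^ m, (2 : ℝ) ^ m) ∧
      -- `ν S(T₁)` is polynomial in `2 ^ m / ε`
      ((2 : ℝ) ^ m / ε) ^ k₁ ≤ ν * volume.real (ChordPPP.rootTriangle a b) ∧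
      ν * volume.real (ChordPPP.rootTriangle a b) ≤ ((2 : ℝ) ^ m / ε) ^ k₂ ∧
      -- for every realization of the process and every exact `Comb` routine
      ∀ (Ω : Type u) [MeasurableSpace Ω] (μ : Measure Ω) [IsProbabilityMeasure μ]
        (Φ : Ω → Finset ChordPPP.Point) (comb : Ω → ℝ≥0∞ → ChordPPP.Point),
        ChordPPP.IsPPP μ ν (ChordPPP.rootTriangle a b) Φ →
        (∀ ω, ChordPPP.IsExactComb (ChordPPP.objectiveSpace a b (Φ ω)) (comb ω)) →
        (∀ᵐ ω ∂μ, ChordPPP.opt ε (ChordPPP.objectiveSpace a b (Φ ω)) ≤ 3) ∧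
        -- the expected performance ratio; as `∫⁻` is the supremum of the integrals of measurable
        -- minorants, the two bounds do not rest on any convention for non-measurable integrands
        ENNReal.ofReal (C * Real.log (Real.log (ν * volume.real (ChordPPP.rootTriangle a b)))) ≤
          ∫⁻ ω, (ChordPPP.chordCalls (comb ω) ε : ℝ≥0∞) /
            (ChordPPP.opt ε (ChordPPP.objectiveSpace a b (Φ ω)) : ℝ≥0∞) ∂μ ∧
        ENNReal.ofReal (C * (Real.log m + Real.log (Real.log (1 / ε)))) ≤
          ∫⁻ ω, (ChordPPP.chordCalls (comb ω) ε : ℝ≥0∞) /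
            (ChordPPP.opt ε (ChordPPP.objectiveSpace a b (Φ ω)) : ℝ≥0∞) ∂μ ∧
        -- with probability at least `p`, the recursion tree has a long path
        ∃ E : Set Ω, MeasurableSet E ∧ ENNReal.ofReal p ≤ μ E ∧
          ∀ ω ∈ E, ∃ w ∈ ChordPPP.recursionTree (comb ω) ε,
            C * Real.log (Real.log (ν * volume.real (ChordPPP.rootTriangle a b))) ≤ w.length ∧
            C * Real.log (Real.log (1 / ε)) ≤ w.length := by
  obtain ⟨G₀, hG₀⟩ := Filter.eventually_atTop.1 ChordPPP.eventually_exists_depth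
  have hM0 : 0 < max G₀ 10 := lt_max_of_lt_right (by norm_num)
  -- `C = 1 / 60` works: the expected ratio is at least `K / 6`, and the logarithms add up to at
  -- most `9 K`
  refine ⟨1 / 60, by norm_num, 1 / 2, by norm_num, (max G₀ 10)⁻¹, inv_pos.2 hM0, 1, one_pos, 2,
    two_pos, fun m ε hm hε hε₀ => ?_⟩
  have h2m : (2 : ℝ) ≤ 2 ^ m := le_self_pow₀ one_le_two (by omega)
  have hinv : ((2 : ℝ) ^ m)⁻¹ ≤ 1 / 2 := by
    rw [one_div]
    gcongr
  have hinv0 : 0 < ((2 : ℝ) ^ m)⁻¹ := by positivity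
  have hεinv : max G₀ 10 ≤ 1 / ε := by
    rw [one_div]
    exact (le_inv_comm₀ hM0 hε).2 hε₀.le
  have h10 : 10 ≤ 1 / ε := (le_max_right _ _).trans hεinv
  have hε' : ε ≤ 1 / 10 := by rwa [le_one_div (by norm_num) hε] at h10
  set G : ℝ := 2 ^ m / ε with hGdef
  have hεG : 1 / ε ≤ G := by
    rw [hGdef]
    gcongr
    linarith
  have hmG : (2 : ℝ) ^ m ≤ G := le_div_self (by positivity) hε (by linarith)
  have hG : 0 < G := by positivity
  obtain ⟨K, R, hK, hRG, hR, hKG, hlogG, hloglogG⟩ :=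
    hG₀ G ((le_max_left _ _).trans (hεinv.trans hεG))
  have hK1 : (1 : ℝ) ≤ K := by exact_mod_cast hK
  set yb : ℝ := ((2 : ℝ) ^ m)⁻¹ with hyb
  set H : ℝ := 2 ^ m - yb with hHdef
  have hH : 3 / 2 ≤ H := by linarith
  have hH0 : 0 < H := by linarith
  set ν : ℝ≥0 := ⟨36 * K * G / (2 * ε * H), by positivity⟩
  have hν : (ν : ℝ) * (2 * ε * H) = 36 * K * G := by
    change 36 * K * G / (2 * ε * H) * (2 * ε * H) = 36 * K * G
    field_simp
  obtain ⟨hvlo, hvup⟩ := ChordPPP.volume_rootTriangle_bounds (yb := yb) hε hH0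
  have hsub := ChordPPP.rootTriangle_subset_Icc (yb := yb) hε hH0
  set T := ChordPPP.rootTriangle (1, yb + H) (1 + 2 * ε, yb) with hT
  set N : ℝ := ν * volume.real T with hN
  have hNlo : G ≤ N := by
    calc G ≤ 9 * K * G := le_mul_of_one_le_left hG.le (by linarith)
      _ = ν * (2 * ε * H) / 4 := by rw [hν]; ring
      _ = ν * (2 * ε * H / 4) := by ring
      _ ≤ N := mul_le_mul_of_nonneg_left hvlo ν.2
  have hNup : N ≤ G ^ 2 := by
    calc N ≤ ν * (2 * ε * H) := mul_le_mul_of_nonneg_left hvup ν.2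
      _ = 36 * K * G := hν
      _ ≤ G * G := by gcongr
      _ = G ^ 2 := by ring
  -- the three iterated logarithms are at most `5 K`
  have hlog2 : Real.log 2 ≤ 1 := by linarith [Real.log_two_lt_d9]
  have hlog2G : Real.log (2 * Real.log G) ≤ 5 * K := by
    rw [Real.log_mul two_ne_zero (by positivity)]
    linarith
  have hlogN : Real.log (Real.log N) ≤ 5 * K := by
    refine le_trans (Real.log_le_log ?_ ?_) hlog2G
    · have := Real.log_le_log hG hNlo
      linarith
    · have := Real.log_le_log (hG.trans_le hNlo) hNup
      rwa [Real.log_pow] at this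
  have hlogm : Real.log m ≤ 5 * K := by
    have hm0 : (0 : ℝ) < m := by exact_mod_cast hm
    refine le_trans (Real.log_le_log hm0 ?_) hlog2G
    have := Real.log_le_log (by positivity) hmG
    rw [Real.log_pow] at this
    have : (m : ℝ) * (1 / 2) ≤ m * Real.log 2 := by
      gcongr
      linarith [Real.log_two_gt_d9]
    linarith
  have hlogε : Real.log (Real.log (1 / ε)) ≤ 4 * K := by
    refine le_trans (Real.log_le_log ?_ ?_) hloglogG
    · exact Real.log_pos (by linarith)
    · exact Real.log_le_log (by positivity) hεG
  refine ⟨(1, yb + H), (1 + 2 * ε, yb), ν, by simp [hε], by simp [hH0], ?_, ?_, ?_, ?_⟩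
  · refine hsub.trans (Icc_subset_Icc ?_ ?_)
    · exact ⟨by simp only; linarith, le_rfl⟩
    · exact ⟨by simp only; linarith, by simp [hHdef]⟩
  · rwa [Real.rpow_one]
  · rwa [Real.rpow_two]
  intro Ω _ μ _ Φ comb hΦ hcomb
  have hopt : ∀ ω, ChordPPP.opt ε (ChordPPP.objectiveSpace (1, yb + H) (1 + 2 * ε, yb) (Φ ω)) ≤
      3 := by
    intro ω
    refine le_trans (ChordPPP.opt_le_two (yb := yb) (a := (1, yb + H)) ?_ hε hinv0 ?_ rfl ?_ ?_)
      (by norm_num)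
    · exact (toFinite _).union (Φ ω).finite_toSet
    · simp [ChordPPP.objectiveSpace]
    · simp [ChordPPP.objectiveSpace]
    · rintro p ((rfl | rfl) | hp)
      · simp [hH0.le]
      · simp [hε.le]
      · exact (hsub (hΦ.subset ω hp)).1
  have hHG : 20 * ε * yb ≤ H * (16 / G) := by
    have : H * (16 / G) = 16 * H * (ε * yb) := by
      rw [hGdef, hyb]
      field_simp
    rw [this]
    have : 0 < ε * yb := by positivity
    nlinarith
  obtain ⟨E, hE, hEμ, hpath⟩ := hΦ.exists_event hε hε' hinv0 hH0 hG hHG hK hRG hR hν hcomb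
  have hEμ' : ENNReal.ofReal (1 / 2) ≤ μ E :=
    (ENNReal.ofReal_le_iff_le_toReal (measure_ne_top μ E)).2 hEμ
  have hint : ENNReal.ofReal (K / 6) ≤ ∫⁻ ω, (ChordPPP.chordCalls (comb ω) ε : ℝ≥0∞) /
      (ChordPPP.opt ε (ChordPPP.objectiveSpace (1, yb + H) (1 + 2 * ε, yb) (Φ ω)) : ℝ≥0∞) ∂μ := by
    calc ENNReal.ofReal (K / 6) = (K : ℝ≥0∞) / 3 * ENNReal.ofReal (1 / 2) := by
          rw [← ENNReal.ofReal_natCast, ← ENNReal.ofReal_ofNat,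
            ← ENNReal.ofReal_div_of_pos (by norm_num), ← ENNReal.ofReal_mul (by positivity)]
          congr 1
          ring
      _ ≤ (K : ℝ≥0∞) / 3 * μ E := by gcongr
      _ = ∫⁻ ω, E.indicator (fun _ => (K : ℝ≥0∞) / 3) ω ∂μ := (lintegral_indicator_const hE _).symm
      _ ≤ _ := by
          refine lintegral_mono (indicator_le fun ω hω => ?_)
          refine ENNReal.div_le_div ?_ ?_
          · exact_mod_cast ENat.toENNReal_le.2 (ChordPPP.le_chordCalls (hpath ω hω))
          · exact_mod_cast ENat.toENNReal_le.2 (hopt ω)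
  refine ⟨Filter.Eventually.of_forall hopt, ?_, ?_, E, hE, hEμ', fun ω hω => ?_⟩
  · exact (ENNReal.ofReal_le_ofReal (by linarith)).trans hint
  · exact (ENNReal.ofReal_le_ofReal (by linarith)).trans hint
  · refine ⟨_, hpath ω hω K le_rfl, ?_⟩
    rw [List.length_replicate]
    exact ⟨by linarith, by linarith⟩
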